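/- Let $E_{\mathbb R}$ and $F_{\mathbb R}$ be real Banach lattices and let $E$ and $F$ be the corresponding complex Banach lattices. That is, $E=\{x+iy : x,y\in E_{\mathbb R}\}$ is the complexification of $E_{\mathbb R}$, with modulus $|x+iy|=\sup\{x\cos\theta+y\sin\theta : 0\le\theta\le 2\pi\}\in E_{\mathbb R}$ and norm $\|z\|=\|\,|z|\,\|$, and likewise for $F$. Assume that $F$ is Dedekind complete, that is, every nonempty subset of $F_{\mathbb R}$ that is bounded above has a least upper bound. Let $m\ge 0$ be an integer. A real $m$-homogeneous polynomial $Q\colon E_{\mathbb R}\to F_{\mathbb R}$, $Q(x)=A(x,\dots,x)$ with $A$ symmetric and $m$-linear, is *positive* if $A(x_1,\dots,x_m)\ge 0$ for all $x_1,\dots,x_m\ge 0$, and *regular* if it is the difference of two positive $m$-homogeneous polynomials. The real regular $m$-homogeneous polynomials are ordered by: $Q_1\le Q_2$ if and only if $Q_2-Q_1$ is positive. A complex $m$-homogeneous polynomial $P\colon E\to F$ is *regular* if the real polynomials $P_0(x)=\operatorname{Re}P(x)$ and $P_1(x)=\operatorname{Im}P(x)$, $x\in E_{\mathbb R}$, are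 regular. Its *absolute value* $|P|$ is the least upper bound of $\{(\cos\theta) P_0+(\sin\theta) P_1 : 0\le\theta\le 2\pi\}$ in the ordered vector space of real regular $m$-homogeneous polynomials from $E_{\mathbb R}$ to $F_{\mathbb R}$. **Proposition 2.5.** For every regular $m$-homogeneous polynomial $P\colon E\to F$, the absolute value $|P|$ exists, and $$|P(z)|\le |P|(|z|)\qquad\text{for all } z\in E .$$ -/

import Mathlib

open Set Filter Topology

/-! ### Complexification of a real vector space -/

/-- The complexification of a real vector space `V`: the vectors `z = x + iy` with `x, y ∈ V`. -/
@[ext]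
structure Complexification (V : Type*) where
  /-- The real part. -/
  re : V
  /-- The imaginary part. -/
  im : V

namespace Complexification

section Algebra

variable {V : Type*} [AddCommGroup V]

instance : Zero (Complexification V) := ⟨⟨0, 0⟩⟩
instance : Add (Complexification V) := ⟨fun z w => ⟨z.re + w.re, z.im + w.im⟩⟩
instance : Neg (Complexification V) := ⟨fun z => ⟨-z.re, -z.im⟩⟩

@[simp] theorem zero_re : (0 : Complexification V).re = 0 := rfl
@[simp] theorem zero_im : (0 : Complexification V).im = 0 := rfl
@[simp] theorem add_re (z w : Complexification V) : (z + w).re = z.re + w.re := rfl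
@[simp] theorem add_im (z w : Complexification V) : (z + w).im = z.im + w.im := rfl
@[simp] theorem neg_re (z : Complexification V) : (-z).re = -z.re := rfl
@[simp] theorem neg_im (z : Complexification V) : (-z).im = -z.im := rfl
instance : AddCommGroup (Complexification V) where
  add_assoc a b c := by ext <;> simp [add_assoc]
  zero_add a := by ext <;> simp
  add_zero a := by ext <;> simp
  nsmul := nsmulRec
  zsmul := zsmulRec
  neg_add_cancel a := by ext <;> simp
  add_comm a b := by ext <;> simp [add_comm]

variable [Module ℝ V]

instance : SMul ℂ (Complexification V) :=
  ⟨fun c z => ⟨c.re • z.re - c.im • z.im, c.re • z.im + c.im • z.re⟩⟩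

@[simp] theorem smul_re (c : ℂ) (z : Complexification V) :
    (c • z).re = c.re • z.re - c.im • z.im := rfl
@[simp] theorem smul_im (c : ℂ) (z : Complexification V) :
    (c • z).im = c.re • z.im + c.im • z.re := rfl

instance : Module ℂ (Complexification V) where
  one_smul a := by ext <;> simp
  mul_smul c d a := by
    ext <;> simp only [smul_re, smul_im, Complex.mul_re, Complex.mul_im] <;> module
  smul_zero c := by ext <;> simp
  smul_add c a b := by ext <;> simp only [smul_re, smul_im, add_re, add_im] <;> module
  add_smul c d a := by
    ext <;> simp only [smul_re, smul_im, add_re, add_im, Complex.add_re, Complex.add_im] <;> module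
  zero_smul a := by ext <;> simp

/-- The canonical embedding `x ↦ x + i0` of `V` in its complexification. -/
def ofReal (x : V) : Complexification V := ⟨x, 0⟩

/-- `u` is the modulus of `z = x + iy`: it is the least upper bound in `V` of the vectors
`x cos θ + y sin θ` with `0 ≤ θ ≤ 2π`. -/
def IsModulus [LE V] (z : Complexification V) (u : V) : Prop :=
  IsLUB ((fun θ : ℝ => Real.cos θ • z.re + Real.sin θ • z.im) '' Icc 0 (2 * Real.pi)) u

end Algebra

/-! ### The modulus on the complexification of a Banach lattice -/

section Lattice

variable {E : Type*} [NormedAddCommGroup E] [NormedSpace ℝ E] [Lattice E] [IsOrderedModule ℝ E]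

theorem smul_le_abs_smul_abs [IsOrderedAddMonoid E] (c : ℝ) (x : E) : c • x ≤ |c| • |x| := by
  rcases le_total 0 c with h | h
  · rw [abs_of_nonneg h]
    exact smul_le_smul_of_nonneg_left (le_abs_self x) h
  · rw [abs_of_nonpos h]
    have := smul_le_smul_of_nonneg_left (neg_le_abs x) (neg_nonneg.2 h)
    simpa using this

variable [IsOrderedAddMonoid E]

theorem rotation_le (x y : E) (θ φ : ℝ) :
    Real.cos θ • x + Real.sin θ • y ≤
      (Real.cos φ • x + Real.sin φ • y) + |θ - φ| • (|x| + |y|) := by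
  have hc : |Real.cos θ - Real.cos φ| ≤ |θ - φ| := Real.abs_cos_sub_cos_le θ φ
  have hs : |Real.sin θ - Real.sin φ| ≤ |θ - φ| := Real.abs_sin_sub_sin_le θ φ
  have h1 : (Real.cos θ - Real.cos φ) • x ≤ |θ - φ| • |x| :=
    (smul_le_abs_smul_abs _ x).trans (smul_le_smul_of_nonneg_right hc (abs_nonneg x))
  have h2 : (Real.sin θ - Real.sin φ) • y ≤ |θ - φ| • |y| :=
    (smul_le_abs_smul_abs _ y).trans (smul_le_smul_of_nonneg_right hs (abs_nonneg y))
  have h3 := add_le_add_left (add_le_add h1 h2) (Real.cos φ • x + Real.sin φ • y)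
  calc Real.cos θ • x + Real.sin θ • y
      = (Real.cos θ - Real.cos φ) • x + (Real.sin θ - Real.sin φ) • y
          + (Real.cos φ • x + Real.sin φ • y) := by module
    _ ≤ _ := h3
    _ = _ := by module

variable [HasSolidNorm E] [CompleteSpace E]

/-- In a Banach lattice, which need not be Dedekind complete, the supremum that defines the
modulus always exists. -/
theorem exists_isModulus (z : Complexification E) : ∃ u, z.IsModulus u := by
  obtain ⟨x, y⟩ := z
  set f : ℝ → E := fun θ => Real.cos θ • x + Real.sin θ • y with hf
  set w : E := |x| + |y| with hw
  have hw0 : 0 ≤ w := add_nonneg (abs_nonneg x) (abs_nonneg y)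
  have hpi := Real.two_pi_pos
  set δ : ℕ → ℝ := fun n => 2 * Real.pi / ((n : ℝ) + 1) with hδ
  have hδ0 : ∀ n, 0 < δ n := fun n => by positivity
  have hδt : Tendsto δ atTop (𝓝 0) := by
    have := tendsto_one_div_add_atTop_nhds_zero_nat (𝕜 := ℝ)
    simpa [hδ, div_eq_mul_inv] using this.const_mul (2 * Real.pi)
  set s : ℕ → E := fun n =>
    (Finset.range (n + 2)).sup' ⟨0, by simp⟩ (fun k => f (k * δ n)) with hs
  have hfs : ∀ n, ∀ θ ∈ Icc 0 (2 * Real.pi), f θ ≤ s n + δ n • w := by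
    intro n θ hθ
    set k := ⌊θ / δ n⌋₊ with hk
    have h0 : 0 ≤ θ / δ n := div_nonneg hθ.1 (hδ0 n).le
    have hk1 : (k : ℝ) ≤ θ / δ n := Nat.floor_le h0
    have hk2 : θ / δ n < k + 1 := Nat.lt_floor_add_one _
    have hle : θ / δ n ≤ (n : ℝ) + 1 := by
      rw [div_le_iff₀ (hδ0 n)]
      have : ((n : ℝ) + 1) * δ n = 2 * Real.pi := by
        simp only [hδ]; field_simp
      rw [this]; exact hθ.2
    have hkn : k < n + 2 := by
      have : (k : ℝ) ≤ ((n + 1 : ℕ) : ℝ) := by push_cast; linarith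
      have := Nat.cast_le.1 this
      omega
    rw [le_div_iff₀ (hδ0 n)] at hk1
    rw [div_lt_iff₀ (hδ0 n)] at hk2
    have habs : |θ - k * δ n| ≤ δ n := by
      rw [abs_of_nonneg (by linarith)]; linarith
    have h1 : f θ ≤ f (k * δ n) + |θ - k * δ n| • w := rotation_le x y θ (k * δ n)
    have h2 : f (k * δ n) ≤ s n :=
      Finset.le_sup' (fun k : ℕ => f (k * δ n)) (Finset.mem_range.2 hkn)
    exact h1.trans (add_le_add h2 (smul_le_smul_of_nonneg_right habs hw0))
  have hsb : ∀ n (v : E), (∀ θ ∈ Icc 0 (2 * Real.pi), f θ ≤ v) → s n ≤ v := by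
    intro n v hv
    refine Finset.sup'_le _ _ fun k hk => hv _ ⟨by have := hδ0 n; positivity, ?_⟩
    have hk' : (k : ℝ) ≤ (n : ℝ) + 1 := by
      have := Finset.mem_range.1 hk
      have : k ≤ n + 1 := by omega
      exact_mod_cast this
    calc (k : ℝ) * δ n ≤ ((n : ℝ) + 1) * δ n := by
          exact mul_le_mul_of_nonneg_right hk' (hδ0 n).le
      _ = 2 * Real.pi := by simp only [hδ]; field_simp
  have hss : ∀ m n, s m ≤ s n + δ n • w := fun m n => hsb m _ (hfs n)
  have hcauchy : CauchySeq s := by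
    refine cauchySeq_of_le_tendsto_0 (fun n => δ n * ‖w‖) ?_ ?_
    · intro a b N ha hb
      have hmono : ∀ c, N ≤ c → δ c ≤ δ N := fun c hc => by
        simp only [hδ]; gcongr
      have key : ∀ c d, N ≤ d → s c - s d ≤ δ N • w := fun c d hd => by
        rw [sub_le_iff_le_add']
        exact (hss c d).trans
          (by gcongr; exact hmono d hd)
      have : |s a - s b| ≤ |δ N • w| := by
        rw [abs_of_nonneg (smul_nonneg (hδ0 N).le hw0), abs_le']
        exact ⟨key a b hb, by rw [neg_sub]; exact key b a ha⟩
      rw [dist_eq_norm]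
      refine (norm_le_norm_of_abs_le_abs this).trans ?_
      rw [norm_smul, Real.norm_of_nonneg (hδ0 N).le]
    · simpa using hδt.mul_const ‖w‖
  obtain ⟨u, hu⟩ := cauchySeq_tendsto_of_complete hcauchy
  refine ⟨u, ?_, ?_⟩
  · rintro _ ⟨θ, hθ, rfl⟩
    have ht : Tendsto (fun n => s n + δ n • w) atTop (𝓝 u) := by
      simpa using hu.add (hδt.smul_const w)
    exact ge_of_tendsto' ht fun n => hfs n θ hθ
  · intro v hv
    exact le_of_tendsto' hu fun n => hsb n v fun θ hθ => hv ⟨θ, hθ, rfl⟩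

/-- The modulus `|z| = sup {x cos θ + y sin θ : 0 ≤ θ ≤ 2π}` of `z = x + iy`, an element of `E`. -/
noncomputable def modulus (z : Complexification E) : E :=
  (exists_isModulus z).choose

theorem isModulus_modulus (z : Complexification E) : z.IsModulus z.modulus :=
  (exists_isModulus z).choose_spec

/-- The norm `‖z‖ = ‖|z|‖` of the complex Banach lattice. -/
noncomputable instance : Norm (Complexification E) := ⟨fun z => ‖z.modulus‖⟩

end Lattice

end Complexification

/-! ### Homogeneous polynomials -/

/-- `P` is generated by the symmetric `m`-linear mapping `A`, that is, `P x = A (x, …, x)`. -/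
def IsGeneratedBy {𝕜 V W : Type*} [CommSemiring 𝕜] [AddCommGroup V] [Module 𝕜 V]
    [AddCommGroup W] [Module 𝕜 W] {m : ℕ} (P : V → W)
    (A : MultilinearMap 𝕜 (fun _ : Fin m => V) W) : Prop :=
  (∀ (σ : Equiv.Perm (Fin m)) (x : Fin m → V), A (fun i => x (σ i)) = A x) ∧
    ∀ x, P x = A (fun _ => x)

/-- `P` is an `m`-homogeneous polynomial over `𝕜`. -/
def IsHomogeneousPolynomial (𝕜 : Type*) {V W : Type*} [CommSemiring 𝕜] [AddCommGroup V]
    [Module 𝕜 V] [AddCommGroup W] [Module 𝕜 W] (m : ℕ) (P : V → W) : Prop :=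
  ∃ A : MultilinearMap 𝕜 (fun _ : Fin m => V) W, IsGeneratedBy P A

/-- Polarization: a symmetric multilinear mapping that vanishes on the diagonal is zero. -/
theorem eq_zero_of_symmetric_of_diagonal {V W : Type*} [AddCommGroup V] [Module ℝ V]
    [AddCommGroup W] [Module ℝ W] {m : ℕ} (A : MultilinearMap ℝ (fun _ : Fin m => V) W)
    (hA : ∀ (σ : Equiv.Perm (Fin m)) (x : Fin m → V), A (fun i => x (σ i)) = A x)
    (h0 : ∀ x, A (fun _ => x) = 0) : A = 0 := by
  classical
  ext x
  have hinner : ∀ r : Fin m → Fin m, ¬ Function.Surjective r →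
      ∑ S : Finset (Fin m), (if ∀ i, r i ∈ S then (-1 : ℝ) ^ S.card else 0) = 0 := by
    intro r hr
    obtain ⟨j, hj⟩ := not_forall.1 hr
    have hj' : ∀ i, r i ≠ j := fun i hi => hj ⟨i, hi⟩
    refine Finset.sum_involution (fun S _ => if j ∈ S then S.erase j else insert j S) ?_ ?_ ?_ ?_
    · intro S _
      by_cases hjS : j ∈ S
      · have h2 : S.card = (S.erase j).card + 1 := (Finset.card_erase_add_one hjS).symm
        simp only [hjS, if_true, Finset.mem_erase, ne_eq, hj', not_false_eq_true, true_and, h2,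
          pow_succ]
        split_ifs <;> simp
      · simp only [hjS, if_false, Finset.mem_insert, hj', false_or,
          Finset.card_insert_of_notMem hjS, pow_succ]
        split_ifs <;> simp
    · intro S _ _ h
      by_cases hjS : j ∈ S
      · simp only [hjS, if_true] at h
        exact Finset.notMem_erase j S (by rw [h]; exact hjS)
      · simp only [hjS, if_false] at h
        exact hjS (by rw [← h]; exact Finset.mem_insert_self j S)
    · intro S _; exact Finset.mem_univ _
    · intro S _
      by_cases hjS : j ∈ S <;> simp [hjS]
  have hsum : ∑ S : Finset (Fin m), (-1 : ℝ) ^ S.card • A (fun _ => ∑ i ∈ S, x i) = 0 := by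
    simp [h0]
  have hexp : ∀ S : Finset (Fin m), (-1 : ℝ) ^ S.card • A (fun _ => ∑ i ∈ S, x i) =
      ∑ r : Fin m → Fin m, (if ∀ i, r i ∈ S then (-1 : ℝ) ^ S.card else 0) •
        A (fun i => x (r i)) := by
    intro S
    rw [A.map_sum_finset (fun _ j => x j) (fun _ => S), Finset.smul_sum]
    simp only [ite_smul, zero_smul]
    rw [← Finset.sum_filter]
    refine Finset.sum_congr ?_ fun _ _ => rfl
    ext r; simp [Fintype.mem_piFinset]
  have hr : ∀ r : Fin m → Fin m,
      (∑ S : Finset (Fin m), (if ∀ i, r i ∈ S then (-1 : ℝ) ^ S.card else 0)) •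
        A (fun i => x (r i)) =
      if Function.Bijective r then (-1 : ℝ) ^ m • A x else 0 := by
    intro r
    by_cases h : Function.Bijective r
    · have : ∀ S : Finset (Fin m), (∀ i, r i ∈ S) ↔ S = Finset.univ := fun S =>
        ⟨fun hS => Finset.eq_univ_iff_forall.2 fun j => by
          obtain ⟨i, rfl⟩ := h.2 j; exact hS i, fun hS => by simp [hS]⟩
      simp only [this, Finset.sum_ite_eq', Finset.mem_univ, if_true, h]
      rw [Finset.card_univ, Fintype.card_fin]
      congr 1
      exact hA (Equiv.ofBijective r h) x
    · have : ¬ Function.Surjective r := fun hs => h ⟨Finite.injective_iff_surjective.2 hs, hs⟩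
      rw [hinner r this, zero_smul, if_neg h]
  rw [Finset.sum_congr rfl fun S _ => hexp S, Finset.sum_comm] at hsum
  simp_rw [← Finset.sum_smul, hr] at hsum
  rw [← Finset.sum_filter, Finset.sum_const, ← Nat.cast_smul_eq_nsmul ℝ, smul_smul] at hsum
  refine (smul_eq_zero.1 hsum).resolve_left (mul_ne_zero ?_ (by simp))
  rw [Nat.cast_ne_zero]
  exact (Finset.card_pos.2 ⟨id, Finset.mem_filter.2 ⟨Finset.mem_univ _, Function.bijective_id⟩⟩).ne'

section Real

variable {E F : Type*} [AddCommGroup E] [Module ℝ E] [Lattice E]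
  [AddCommGroup F] [Module ℝ F] [Lattice F]

/-- `P` is an `m`-homogeneous polynomial whose generating symmetric `m`-linear mapping takes
nonnegative values at nonnegative arguments. (By polarization the mapping is unique.) -/
def IsPositivePolynomial (m : ℕ) (P : E → F) : Prop :=
  ∃ A : MultilinearMap ℝ (fun _ : Fin m => E) F, IsGeneratedBy P A ∧
    ∀ x : Fin m → E, (∀ i, 0 ≤ x i) → 0 ≤ A x

/-- `P` is the difference of two positive `m`-homogeneous polynomials. -/
def IsRegularPolynomial (m : ℕ) (P : E → F) : Prop :=
  ∃ P₁ P₂ : E → F, IsPositivePolynomial m P₁ ∧ IsPositivePolynomial m P₂ ∧ P = P₁ - P₂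

theorem IsPositivePolynomial.zero (m : ℕ) : IsPositivePolynomial m (0 : E → F) :=
  ⟨0, ⟨fun _ _ => rfl, fun _ => rfl⟩, fun _ _ => le_rfl⟩

theorem IsPositivePolynomial.add [IsOrderedAddMonoid F] {m : ℕ} {P Q : E → F}
    (hP : IsPositivePolynomial m P) (hQ : IsPositivePolynomial m Q) :
    IsPositivePolynomial m (P + Q) := by
  obtain ⟨A, ⟨hA, hPA⟩, hA0⟩ := hP
  obtain ⟨B, ⟨hB, hQB⟩, hB0⟩ := hQ
  exact ⟨A + B, ⟨fun σ x => by simp [hA σ x, hB σ x], fun x => by simp [hPA, hQB]⟩,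
    fun x hx => add_nonneg (hA0 x hx) (hB0 x hx)⟩

theorem IsPositivePolynomial.smul [IsOrderedModule ℝ F] {m : ℕ} {P : E → F}
    (hP : IsPositivePolynomial m P) {c : ℝ} (hc : 0 ≤ c) : IsPositivePolynomial m (c • P) := by
  obtain ⟨A, ⟨hA, hPA⟩, hA0⟩ := hP
  exact ⟨c • A, ⟨fun σ x => by simp [hA σ x], fun x => by simp [hPA]⟩,
    fun x hx => smul_nonneg hc (hA0 x hx)⟩

/-- A positive polynomial whose negative is positive is zero. -/
theorem IsPositivePolynomial.eq_zero [IsOrderedAddMonoid E] [IsOrderedAddMonoid F] {m : ℕ}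
    {P : E → F} (hP : IsPositivePolynomial m P) (hP' : IsPositivePolynomial m (-P)) : P = 0 := by
  obtain ⟨A, ⟨hA, hPA⟩, hA0⟩ := hP
  obtain ⟨B, ⟨hB, hPB⟩, hB0⟩ := hP'
  have hAB : A + B = 0 := by
    refine eq_zero_of_symmetric_of_diagonal _ (fun σ x => by simp [hA σ x, hB σ x]) fun x => ?_
    simp [← hPA, ← hPB]
  have hcone : ∀ x : Fin m → E, (∀ i, 0 ≤ x i) → A x = 0 := fun x hx => by
    have h1 : A x + B x = 0 := by
      rw [← add_apply, hAB, zero_apply]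
    exact le_antisymm (by rw [eq_neg_of_add_eq_zero_left h1]; exact neg_nonpos.2 (hB0 x hx))
      (hA0 x hx)
  funext x
  have hx : (fun _ : Fin m => x) = (fun _ => x⁺) + fun _ => (-1 : ℝ) • x⁻ := by
    funext i
    simp only [Pi.add_apply, neg_smul, one_smul, ← sub_eq_add_neg, posPart_sub_negPart]
  rw [hPA, hx, A.map_add_univ, Pi.zero_apply]
  refine Finset.sum_eq_zero fun s _ => ?_
  have hs : s.piecewise (fun _ : Fin m => x⁺) (fun _ => (-1 : ℝ) • x⁻) =
      fun i => (if i ∈ s then (1 : ℝ) else -1) • (if i ∈ s then x⁺ else x⁻) := by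
    funext i
    by_cases h : i ∈ s <;> simp [h]
  rw [hs, A.map_smul_univ, hcone, smul_zero]
  intro i
  split_ifs
  exacts [posPart_nonneg x, negPart_nonneg x]

/-- The real vector space of regular `m`-homogeneous polynomials from `E` to `F`. -/
def regularPolynomials (m : ℕ) (E F : Type*) [AddCommGroup E] [Module ℝ E] [Lattice E]
    [AddCommGroup F] [Module ℝ F] [Lattice F] [IsOrderedAddMonoid F] [IsOrderedModule ℝ F] :
    Submodule ℝ (E → F) where
  carrier := {P | IsRegularPolynomial m P}
  zero_mem' := ⟨0, 0, .zero m, .zero m, by simp⟩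
  add_mem' := by
    rintro _ _ ⟨P, Q, hP, hQ, rfl⟩ ⟨P', Q', hP', hQ', rfl⟩
    exact ⟨P + P', Q + Q', hP.add hP', hQ.add hQ', by abel⟩
  smul_mem' := by
    rintro c _ ⟨P, Q, hP, hQ, rfl⟩
    rcases le_total 0 c with h | h
    · exact ⟨c • P, c • Q, hP.smul h, hQ.smul h, smul_sub _ _ _⟩
    · exact ⟨(-c) • Q, (-c) • P, hQ.smul (neg_nonneg.2 h), hP.smul (neg_nonneg.2 h), by module⟩

/-- The ordered vector space of regular `m`-homogeneous polynomials from `E` to `F`. Its order is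
not the pointwise one: `P ≤ Q` means that the polynomial `Q - P` is positive. -/
def RegularPolynomial (m : ℕ) (E F : Type*) [AddCommGroup E] [Module ℝ E] [Lattice E]
    [AddCommGroup F] [Module ℝ F] [Lattice F] [IsOrderedAddMonoid F] [IsOrderedModule ℝ F] :
    Type _ :=
  regularPolynomials m E F

namespace RegularPolynomial

variable [IsOrderedAddMonoid F] [IsOrderedModule ℝ F] {m : ℕ}

instance : AddCommGroup (RegularPolynomial m E F) :=
  inferInstanceAs (AddCommGroup (regularPolynomials m E F))

instance : Module ℝ (RegularPolynomial m E F) :=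
  inferInstanceAs (Module ℝ (regularPolynomials m E F))

instance : CoeFun (RegularPolynomial m E F) (fun _ => E → F) := ⟨Subtype.val⟩

instance [IsOrderedAddMonoid E] : PartialOrder (RegularPolynomial m E F) where
  le P Q := IsPositivePolynomial m (fun x => Q x - P x)
  le_refl P := by
    have : (fun x => P x - P x) = 0 := by funext x; simp
    rw [this]; exact .zero m
  le_trans P Q R h h' := by
    have : (fun x => R x - P x) = (fun x => Q x - P x) + fun x => R x - Q x := by
      funext x; simp
    rw [this]; exact h.add h'
  le_antisymm P Q h h' := by
    have h0 : (fun x => Q x - P x) = 0 := by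
      refine h.eq_zero ?_
      have : -(fun x => Q x - P x) = fun x => P x - Q x := by funext x; simp
      rw [this]; exact h'
    exact Subtype.ext (funext fun x => (sub_eq_zero.1 (congrFun h0 x)).symm)

end RegularPolynomial

end Real

/-! ### Regular polynomials between complex Banach lattices -/

section Complex

open Complexification

variable (m : ℕ) (E F : Type*) [AddCommGroup E] [Module ℝ E] [Lattice E]
  [AddCommGroup F] [Module ℝ F] [Lattice F]

/-- A regular `m`-homogeneous polynomial between the complexifications of `E` and `F`: a complex
`m`-homogeneous polynomial `P` whose real and imaginary parts, which are the real polynomials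
`x ↦ Re P(x)` and `x ↦ Im P(x)` of the real variable `x ∈ E`, are regular. -/
structure ComplexRegularPolynomial where
  /-- The underlying function. -/
  toFun : Complexification E → Complexification F
  isHomogeneous : IsHomogeneousPolynomial ℂ m toFun
  regular_re : IsRegularPolynomial m (fun x : E => (toFun (ofReal x)).re)
  regular_im : IsRegularPolynomial m (fun x : E => (toFun (ofReal x)).im)

namespace ComplexRegularPolynomial

variable {m E F}

instance : CoeFun (ComplexRegularPolynomial m E F)
    (fun _ => Complexification E → Complexification F) := ⟨toFun⟩

/-- The decomposition `P = P₀ + i P₁`, where `P₀` and `P₁` are the real and imaginary parts of `P`,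
as an element of the complexification of the space of real regular polynomials. -/
def parts [IsOrderedAddMonoid F] [IsOrderedModule ℝ F] (P : ComplexRegularPolynomial m E F) :
    Complexification (RegularPolynomial m E F) :=
  ⟨⟨fun x => (P (ofReal x)).re, P.regular_re⟩, ⟨fun x => (P (ofReal x)).im, P.regular_im⟩⟩

/-- `Q` is the absolute value `|P|` of `P = P₀ + i P₁`: it is the least upper bound of the
polynomials `(cos θ) P₀ + (sin θ) P₁`, `0 ≤ θ ≤ 2π`, in the ordered vector space of real regular
`m`-homogeneous polynomials. -/
def IsAbs [IsOrderedAddMonoid E] [IsOrderedAddMonoid F] [IsOrderedModule ℝ F]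
    (P : ComplexRegularPolynomial m E F) (Q : RegularPolynomial m E F) : Prop :=
  P.parts.IsModulus Q

end ComplexRegularPolynomial

end Complex

/-! Let `A` generate `P`. The rotations `Re (c A)`, `‖c‖ = 1`, restricted to real vectors, are
symmetric real multilinear maps, and regularity of the real and imaginary parts bounds them all on
the positive cone by one multilinear map. Dedekind completeness then gives a Riesz–Kantorovich
supremum `S`: at a positive tuple, the supremum of all sums obtained by repeatedly splitting
coordinates and choosing a rotation for each final piece (`PartitionSum`). Common refinements make
`S` additive in each variable on the cone (`isConeMultilinear_sSup_partitionSum`); an alternating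
sum over positive and negative parts extends it to all vectors (`IsConeMultilinear.extension`). The
polynomial generated by `S` is `|P|`.

For the inequality, put `u = |z|`. The main point, `RotationsLE.exists_mem_unimodularSums`, writes
`z` exactly as a finite sum `∑ cᵢ aᵢ` with `‖cᵢ‖ = 1`, `aᵢ ≥ 0` and `∑ aᵢ ≤ (1 + ε) u`. It uses only
lattice operations: folding the plane along bisectors halves the sector containing `z` until `z` is
nearly real, and each fold can be undone without changing the sum of the `aᵢ`. Expanding `A` over
such sums turns each term into a rotation of `A` at positive vectors, which `S` dominates, so `Re (c
P(z)) ≤ (1 + ε) ^ m S(u, …, u)`. Let `ε → 0`, then take the supremum over `c`. -/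

/-! ### Riesz decomposition -/

section RieszDecomposition

variable {E : Type*} [AddCommGroup E] [Lattice E] [IsOrderedAddMonoid E]

/-- The Riesz decomposition property: two decompositions of a positive vector have a common
refinement. -/
theorem exists_common_refinement {a b c d : E} (ha : 0 ≤ a) (hb : 0 ≤ b) (hc : 0 ≤ c)
    (hd : 0 ≤ d) (h : a + b = c + d) :
    ∃ p q r s : E, 0 ≤ p ∧ 0 ≤ q ∧ 0 ≤ r ∧ 0 ≤ s ∧
      a = p + q ∧ b = r + s ∧ c = p + r ∧ d = q + s := by
  have hb' : b = c + d - a := by rw [← h]; abel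
  -- This vector equals `d ⊓ b`, since `d - a + c = b`.
  have hs : 0 ≤ d - a + a ⊓ c := by
    rw [add_inf]
    refine le_inf (by simpa using hd) ?_
    have : d - a + c = b := by rw [hb']; abel
    rwa [this]
  exact ⟨a ⊓ c, a - a ⊓ c, c - a ⊓ c, d - a + a ⊓ c, le_inf ha hc, sub_nonneg.2 inf_le_left,
    sub_nonneg.2 inf_le_right, hs, by abel, by rw [hb']; abel, by abel, by abel⟩

/-- The Riesz decomposition property for vectors of arbitrary sign. -/
theorem exists_add_eq_of_abs_le_add {x a b : E} (ha : 0 ≤ a) (hb : 0 ≤ b)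
    (h : |x| ≤ a + b) : ∃ y z : E, x = y + z ∧ |y| ≤ a ∧ |z| ≤ b := by
  obtain ⟨h1, h2⟩ := abs_le'.1 h
  -- The first summand is `x` truncated to the order interval from `-a` to `a`.
  refine ⟨x ⊓ a ⊔ -a, x - (x ⊓ a ⊔ -a), by abel, ?_, ?_⟩
  · rw [abs_le', neg_le]
    exact ⟨sup_le inf_le_right ((neg_nonpos.2 ha).trans ha), le_sup_right⟩
  · rw [abs_le', neg_sub, sub_le_iff_le_add, sub_le_iff_le_add]
    constructor
    · rw [← sub_le_iff_le_add']
      refine le_sup_of_le_left (le_inf (sub_le_self _ hb) ?_)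
      rwa [sub_le_iff_le_add]
    · refine sup_le (inf_le_left.trans (le_add_of_nonneg_left hb)) ?_
      rw [neg_le_iff_add_nonneg]
      have := neg_le_iff_add_nonneg.1 h2
      rwa [add_comm b x, add_assoc, add_comm b a, add_comm x]

end RieszDecomposition

/-! ### Decomposition of complex vectors into rotated positive vectors -/

namespace Complexification

@[simp] theorem ofReal_re {V : Type*} [AddCommGroup V] (x : V) : (ofReal x).re = x := rfl
@[simp] theorem ofReal_im {V : Type*} [AddCommGroup V] (x : V) : (ofReal x).im = 0 := rfl

/-- Translates between unimodular factors and angles: `Re (c z)` has coefficients `c.re` and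
`-c.im`, so the angle is the argument of the conjugate of `c`, moved by `2π` when it is not
positive. -/
theorem exists_angle {c : ℂ} (hc : ‖c‖ = 1) :
    ∃ θ ∈ Icc 0 (2 * Real.pi), Real.cos θ = c.re ∧ Real.sin θ = -c.im := by
  set d : ℂ := (starRingEnd ℂ) c with hd
  have hd1 : ‖d‖ = 1 := by simp [hd, hc]
  have hd0 : d ≠ 0 := by rw [← norm_ne_zero_iff, hd1]; exact one_ne_zero
  have hcos : Real.cos d.arg = c.re := by rw [Complex.cos_arg hd0, hd1]; simp [hd]
  have hsin : Real.sin d.arg = -c.im := by rw [Complex.sin_arg, hd1]; simp [hd]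
  have hpi := Real.pi_pos
  have h1 := Complex.neg_pi_lt_arg d
  have h2 := Complex.arg_le_pi d
  rcases le_total 0 d.arg with h0 | h0
  · exact ⟨d.arg, ⟨h0, by linarith⟩, hcos, hsin⟩
  · exact ⟨d.arg + 2 * Real.pi, ⟨by linarith, by linarith⟩, by simpa using hcos, by simpa using hsin⟩

section Decomposition

variable {E : Type*} [AddCommGroup E] [Lattice E] [Module ℝ E]

/-- The pairs `(∑ cᵢ • aᵢ, ∑ aᵢ)` with `cᵢ` unimodular complex numbers and `aᵢ` positive vectors. -/
def unimodularSums (E : Type*) [AddCommGroup E] [Lattice E] [Module ℝ E] :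
    AddSubmonoid (Complexification E × E) :=
  AddSubmonoid.closure {p | ∃ c : ℂ, ‖c‖ = 1 ∧ 0 ≤ p.2 ∧ p.1 = c • ofReal p.2}

theorem smul_ofReal_mem_unimodularSums {c : ℂ} (hc : ‖c‖ = 1) {a : E} (ha : 0 ≤ a) :
    (c • ofReal a, a) ∈ unimodularSums E :=
  AddSubmonoid.subset_closure ⟨c, hc, ha, rfl⟩

theorem smul_mem_unimodularSums {c : ℂ} (hc : ‖c‖ = 1) {p : Complexification E × E}
    (hp : p ∈ unimodularSums E) : (c • p.1, p.2) ∈ unimodularSums E := by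
  induction hp using AddSubmonoid.closure_induction with
  | mem p hp =>
    obtain ⟨d, hd, ha, h⟩ := hp
    rw [h, smul_smul]
    exact smul_ofReal_mem_unimodularSums (by simp [hc, hd]) ha
  | zero => simp only [Prod.fst_zero, Prod.snd_zero, smul_zero]; exact (unimodularSums E).zero_mem
  | add p q _ _ hp hq => simpa using (unimodularSums E).add_mem hp hq

/-- `u` dominates all rotations of `z`. -/
def RotationsLE (z : Complexification E) (u : E) : Prop :=
  ∀ c : ℂ, ‖c‖ = 1 → (c • z).re ≤ u

theorem RotationsLE.smul {z : Complexification E} {u : E} (h : RotationsLE z u) {c : ℂ}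
    (hc : ‖c‖ = 1) : RotationsLE (c • z) u := fun d hd => by
  rw [smul_smul]
  exact h _ (by simp [hc, hd])

theorem IsModulus.rotationsLE {z : Complexification E} {u : E} (h : z.IsModulus u) :
    RotationsLE z u := by
  intro c hc
  obtain ⟨θ, hθ, hcos, hsin⟩ := exists_angle hc
  have := h.1 ⟨θ, hθ, rfl⟩
  simpa [hcos, hsin, sub_eq_add_neg] using this

variable [IsOrderedAddMonoid E] [IsOrderedModule ℝ E]

theorem RotationsLE.nonneg {z : Complexification E} {u : E} (h : RotationsLE z u) : 0 ≤ u := by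
  have h1 := h 1 (by simp)
  have h2 := h (-1) (by simp)
  have h3 : (0 : E) ≤ (2 : ℝ) • u := by
    have := add_le_add h1 h2
    simpa [two_smul] using this
  simpa using smul_nonneg (by norm_num : (0 : ℝ) ≤ 2⁻¹) h3

omit [IsOrderedAddMonoid E] in
theorem abs_smul_le (c : ℝ) (x : E) : |c • x| ≤ |c| • |x| := by
  have key : ∀ {d : ℝ} {y : E}, 0 ≤ d → |d • y| ≤ d • |y| := fun {d y} hd => by
    rw [abs_le', ← smul_neg]
    exact ⟨smul_le_smul_of_nonneg_left (le_abs_self y) hd,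
      smul_le_smul_of_nonneg_left (neg_le_abs y) hd⟩
  rcases le_total 0 c with h | h
  · rw [abs_of_nonneg h]; exact key h
  · rw [abs_of_nonpos h, ← abs_neg, ← neg_smul]; exact key (neg_nonneg.2 h)

/-- Shrinking the real part of `z` does not increase the sums that represent `z`. -/
theorem mem_unimodularSums_of_abs_re_le {p : Complexification E × E} (hp : p ∈ unimodularSums E)
    {x : E} (hx : |x| ≤ |p.1.re|) : ((⟨x, p.1.im⟩ : Complexification E), p.2) ∈ unimodularSums E := by
  induction hp using AddSubmonoid.closure_induction generalizing x with
  | mem p hp =>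
    obtain ⟨c, hc, ha, h⟩ := hp
    obtain ⟨z, a⟩ := p
    simp only at h ha hx ⊢
    subst h
    simp only [smul_re, smul_im, ofReal_re, ofReal_im, smul_zero, sub_zero, zero_add] at hx ⊢
    by_cases h0 : c.re = 0
    · have : x = 0 := by
        rw [h0, zero_smul, abs_zero] at hx
        obtain ⟨h1, h2⟩ := abs_le'.1 hx
        exact le_antisymm h1 (neg_nonpos.1 h2)
      have h2 := smul_ofReal_mem_unimodularSums hc ha
      convert h2 using 2
      ext <;> simp [this, h0]
    -- With `t = c.re⁻¹ • x`, the new vector is `c (a + t)/2 + (-c̄) (a - t)/2`. The factors `c` and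
    -- `-c̄` have opposite real and equal imaginary parts, and the two positive weights still add up
    -- to `a`.
    · have hxa : |c.re⁻¹ • x| ≤ a := by
        refine (abs_smul_le _ _).trans ?_
        have h1 : |x| ≤ |c.re| • a := by
          refine hx.trans ((abs_smul_le _ _).trans ?_)
          rw [abs_of_nonneg ha]
        have h2 := smul_le_smul_of_nonneg_left h1 (abs_nonneg c.re⁻¹)
        rwa [smul_smul, ← abs_mul, inv_mul_cancel₀ h0, abs_one, one_smul] at h2
      obtain ⟨h1, h2⟩ := abs_le'.1 hxa
      have h3 : 0 ≤ (2⁻¹ : ℝ) • (a + c.re⁻¹ • x) := by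
        refine smul_nonneg (by norm_num) ?_
        rw [add_comm]; exact neg_le_iff_add_nonneg'.1 h2
      have h4 : 0 ≤ (2⁻¹ : ℝ) • (a - c.re⁻¹ • x) :=
        smul_nonneg (by norm_num) (sub_nonneg.2 h1)
      have hc' : ‖-(starRingEnd ℂ) c‖ = 1 := by simp [hc]
      convert (unimodularSums E).add_mem (smul_ofReal_mem_unimodularSums hc h3)
        (smul_ofReal_mem_unimodularSums hc' h4) using 1
      ext
      · have : x = (c.re * c.re⁻¹) • x := by rw [mul_inv_cancel₀ h0, one_smul]
        simp only [Prod.mk_add_mk, add_re, smul_re, ofReal_re, ofReal_im, smul_zero, sub_zero,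
          Complex.neg_re, Complex.conj_re]
        nth_rw 1 [this]
        module
      · simp only [Prod.mk_add_mk, add_im, smul_im, ofReal_re, ofReal_im, smul_zero, zero_add,
          Complex.neg_im, Complex.conj_im]
        module
      · simp only [Prod.mk_add_mk]
        module
  | zero =>
    have : x = 0 := by
      simp only [Prod.fst_zero, zero_re, abs_zero] at hx
      obtain ⟨h1, h2⟩ := abs_le'.1 hx
      exact le_antisymm h1 (neg_nonpos.1 h2)
    subst this
    exact (unimodularSums E).zero_mem
  | add p q _ _ hp hq =>
    -- Riesz decomposition distributes the smaller real part over the two summands.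
    obtain ⟨y, z, rfl, hy, hz⟩ := exists_add_eq_of_abs_le_add (abs_nonneg _) (abs_nonneg _)
      (hx.trans (abs_add_le p.1.re q.1.re))
    exact (unimodularSums E).add_mem (hp hy) (hq hz)

/-- Shrinking the imaginary part of `z` does not increase the sums that represent `z`. -/
theorem mem_unimodularSums_of_abs_im_le {p : Complexification E × E} (hp : p ∈ unimodularSums E)
    {y : E} (hy : |y| ≤ |p.1.im|) : ((⟨p.1.re, y⟩ : Complexification E), p.2) ∈ unimodularSums E := by
  have h1 := smul_mem_unimodularSums (c := -Complex.I) (by simp) hp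
  have h2 := mem_unimodularSums_of_abs_re_le h1 (x := y) (by simpa using hy)
  have h3 := smul_mem_unimodularSums (c := Complex.I) (by simp) h2
  convert h3 using 2
  ext <;> simp

/-- The coefficient of `|y|` is `-c.im`. If it is nonpositive, replacing `|y|` by `y` only increases
the left side. If it is nonnegative, the bound follows from those for `y` and `-y`, given by `c` and
its conjugate. -/
theorem RotationsLE.abs_im {x y u : E} (h : RotationsLE ⟨x, y⟩ u) : RotationsLE ⟨x, |y|⟩ u := by
  intro c hc
  have h1 := h c hc
  have h2 := h ((starRingEnd ℂ) c) (by simpa using hc)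
  simp only [smul_re, Complex.conj_re, Complex.conj_im, neg_smul, sub_neg_eq_add] at h1 h2 ⊢
  have key : ∀ {d : ℝ}, 0 ≤ d → ∀ {v : E}, d • y ≤ v → -(d • y) ≤ v → d • |y| ≤ v := by
    intro d hd v hv hv'
    rcases hd.eq_or_lt with rfl | hd
    · simpa using hv
    · rw [← le_inv_smul_iff_of_pos hd, abs_le', le_inv_smul_iff_of_pos hd,
        le_inv_smul_iff_of_pos hd, smul_neg]
      exact ⟨hv, hv'⟩
  rcases le_total 0 c.im with h0 | h0
  · refine le_trans ?_ h1
    exact sub_le_sub_left (smul_le_smul_of_nonneg_left (le_abs_self y) h0) _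
  · have := key (neg_nonneg.2 h0) (v := u - c.re • x) (by
      rw [le_sub_iff_add_le', neg_smul, ← sub_eq_add_neg]; exact h1) (by
      rw [le_sub_iff_add_le', neg_smul, neg_neg]; exact h2)
    rwa [le_sub_iff_add_le', neg_smul, ← sub_eq_add_neg] at this

theorem RotationsLE.abs_re {x y u : E} (h : RotationsLE ⟨x, y⟩ u) : RotationsLE ⟨|x|, y⟩ u := by
  have h1 : RotationsLE ⟨-y, x⟩ u := by
    convert h.smul (c := Complex.I) (by simp) using 1
    ext <;> simp
  convert h1.abs_im.smul (c := -Complex.I) (by simp) using 1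
  ext <;> simp

/-- Folding along the bisector of a sector. -/
theorem exists_half_sector {α : ℝ} (hα0 : 0 ≤ α) (hα : α ≤ Real.pi / 2) {x y u : E} (hx : 0 ≤ x)
    (hy : 0 ≤ y) (hxy : Real.cos α • y ≤ Real.sin α • x) (h : RotationsLE ⟨x, y⟩ u) :
    ∃ x' y' : E, 0 ≤ x' ∧ 0 ≤ y' ∧ Real.cos (α / 2) • y' ≤ Real.sin (α / 2) • x' ∧
      RotationsLE ⟨x', y'⟩ u ∧ ∀ b, ((⟨x', y'⟩ : Complexification E), b) ∈ unimodularSums E →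
        ((⟨x, y⟩ : Complexification E), b) ∈ unimodularSums E := by
  have hpi := Real.pi_pos
  set s := Real.sin (α / 2) with hs
  set c := Real.cos (α / 2) with hc
  have hs0 : 0 ≤ s := Real.sin_nonneg_of_nonneg_of_le_pi (by linarith) (by linarith)
  have hc0 : 0 ≤ c := Real.cos_nonneg_of_neg_pi_div_two_le_of_le (by linarith) (by linarith)
  have hsc : c ^ 2 + s ^ 2 = 1 := Real.cos_sq_add_sin_sq _
  have hsin : Real.sin α = 2 * s * c := by
    rw [hs, hc, ← Real.sin_two_mul]; ring_nf
  have hcos : Real.cos α = c ^ 2 - s ^ 2 := by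
    rw [hs, hc, ← Real.cos_two_mul']; ring_nf
  have hn : ‖(⟨c, -s⟩ : ℂ)‖ = 1 := by
    rw [Complex.norm_eq_sqrt_sq_add_sq]; simp [hsc]
  have hn' : ‖(⟨c, s⟩ : ℂ)‖ = 1 := by
    rw [Complex.norm_eq_sqrt_sq_add_sq]; simp [hsc]
  -- Rotate by `-α/2`, so that the bisector becomes the real axis, then reflect the lower half onto
  -- the upper.
  refine ⟨c • x + s • y, |c • y - s • x|,
    add_nonneg (smul_nonneg hc0 hx) (smul_nonneg hs0 hy), abs_nonneg _, ?_, ?_, ?_⟩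
  -- By the double angle formulas, one half of this is the sector condition `hxy`; the other reduces
  -- to `0 ≤ (c ^ 2 + s ^ 2) • y`.
  · have h1 : |c • (c • y - s • x)| ≤ s • (c • x + s • y) := by
      rw [abs_le']
      constructor
      · rw [hsin, hcos] at hxy
        rw [← sub_nonneg] at hxy ⊢
        refine hxy.trans_eq ?_
        module
      · rw [← sub_nonneg]
        have : 0 ≤ (c ^ 2 + s ^ 2) • y := by rw [hsc, one_smul]; exact hy
        refine this.trans_eq ?_
        module
    rcases hc0.eq_or_lt with h0 | h0
    · rw [← h0] at h1 ⊢
      simpa using h1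
    · rw [← le_inv_smul_iff_of_pos h0, abs_le', le_inv_smul_iff_of_pos h0,
        le_inv_smul_iff_of_pos h0, smul_neg]
      exact abs_le'.1 h1
  · refine RotationsLE.abs_im ?_
    convert h.smul hn using 1
    ext <;> simp [sub_eq_add_neg]
  · intro b hb
    -- Undo the fold: the unreflected imaginary part has the same absolute value. Then rotate back.
    have h1 := mem_unimodularSums_of_abs_im_le hb (y := c • y - s • x) (by simp)
    convert smul_mem_unimodularSums hn' h1 using 2
    ext
    · simp only [smul_re]
      have : x = (c ^ 2 + s ^ 2) • x := by rw [hsc, one_smul]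
      nth_rw 1 [this]
      module
    · simp only [smul_im]
      have : y = (c ^ 2 + s ^ 2) • y := by rw [hsc, one_smul]
      nth_rw 1 [this]
      module

/-- After `n` folds the angle is at most `α / 2 ^ n`. There the crude decomposition into real and
imaginary parts is good enough: its cost is `x + y`, with `x ≤ u` and `y` at most the tangent of
that angle times `x`. -/
theorem exists_mem_unimodularSums_of_sector (n : ℕ) {α : ℝ} (hα0 : 0 ≤ α) (hα : α < Real.pi / 2)
    {x y u : E} (hx : 0 ≤ x) (hy : 0 ≤ y) (hxy : Real.cos α • y ≤ Real.sin α • x)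
    (h : RotationsLE ⟨x, y⟩ u) :
    ∃ b, ((⟨x, y⟩ : Complexification E), b) ∈ unimodularSums E ∧
      b ≤ (1 + Real.tan (α / 2 ^ n)) • u := by
  induction n generalizing α x y with
  | zero =>
    have hc0 : 0 < Real.cos α := Real.cos_pos_of_mem_Ioo ⟨by linarith, hα⟩
    have hxu : x ≤ u := by simpa using h 1 (by simp)
    refine ⟨x + y, ?_, ?_⟩
    · convert (unimodularSums E).add_mem (smul_ofReal_mem_unimodularSums (c := 1) (by simp) hx)
        (smul_ofReal_mem_unimodularSums (c := Complex.I) (by simp) hy) using 1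
      ext <;> simp
    · have hy' : y ≤ Real.tan α • x := by
        rw [Real.tan_eq_sin_div_cos, div_eq_inv_mul, mul_smul, le_inv_smul_iff_of_pos hc0]
        exact hxy
      have ht : 0 ≤ Real.tan α := Real.tan_nonneg_of_nonneg_of_le_pi_div_two hα0 hα.le
      rw [pow_zero, div_one, add_smul, one_smul]
      exact add_le_add hxu (hy'.trans (smul_le_smul_of_nonneg_left hxu ht))
  | succ n ih =>
    obtain ⟨x', y', hx', hy', hxy', h', hb⟩ := exists_half_sector hα0 hα.le hx hy hxy h
    obtain ⟨b, hb1, hb2⟩ := ih (by linarith) (by linarith) hx' hy' hxy' h'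
    exact ⟨b, hb b hb1, by rwa [pow_succ', ← div_div]⟩

/-- If all rotations of `z` lie below `u`, then `z` is a sum of rotated positive vectors whose sum
is arbitrarily close to being dominated by `u`. -/
theorem RotationsLE.exists_mem_unimodularSums {z : Complexification E} {u : E}
    (h : RotationsLE z u) {ε : ℝ} (hε : 0 < ε) :
    ∃ b, (z, b) ∈ unimodularSums E ∧ b ≤ (1 + ε) • u := by
  have hpi := Real.pi_pos
  -- In the first quadrant the sector condition for `π / 2` is automatic. One preliminary fold
  -- brings the angle to `π / 4`, where the tangent is finite.
  obtain ⟨x', y', hx', hy', hxy', h', hb⟩ := exists_half_sector (α := Real.pi / 2) (by linarith)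
    le_rfl (abs_nonneg z.re) (abs_nonneg z.im) (by simp)
    (RotationsLE.abs_re (RotationsLE.abs_im h))
  have ht : Tendsto (fun n : ℕ => Real.tan (Real.pi / 2 / 2 / 2 ^ n)) atTop (𝓝 0) := by
    have h1 : Tendsto (fun n : ℕ => Real.pi / 2 / 2 / 2 ^ n) atTop (𝓝 0) :=
      tendsto_const_nhds.div_atTop (tendsto_pow_atTop_atTop_of_one_lt one_lt_two)
    have h2 : ContinuousAt Real.tan 0 := Real.continuousAt_tan.2 (by simp)
    rw [ContinuousAt, Real.tan_zero] at h2
    exact h2.comp h1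
  obtain ⟨n, hn⟩ := (ht.eventually (gt_mem_nhds hε)).exists
  obtain ⟨b, hb1, hb2⟩ := exists_mem_unimodularSums_of_sector n (by linarith) (by linarith)
    hx' hy' hxy' h'
  refine ⟨b, ?_, hb2.trans (smul_le_smul_of_nonneg_right (by linarith) h.nonneg)⟩
  have h1 := mem_unimodularSums_of_abs_im_le (hb b hb1) (y := z.im) (by simp)
  exact mem_unimodularSums_of_abs_re_le h1 (x := z.re) (by simp)

omit [IsOrderedModule ℝ E] in
theorem nonneg_of_mem_unimodularSums {p : Complexification E × E} (hp : p ∈ unimodularSums E) :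
    0 ≤ p.2 := by
  induction hp using AddSubmonoid.closure_induction with
  | mem p hp => obtain ⟨_, _, h, _⟩ := hp; exact h
  | zero => exact le_rfl
  | add p q _ _ hp hq => exact add_nonneg hp hq

end Decomposition

end Complexification

/-! ### Suprema of families of multilinear maps -/

namespace MultilinearMap

/-! ### Riesz–Kantorovich sums over iterated splittings. -/

section PartitionSum

variable {ι E F : Type*} {m : ℕ} [AddCommGroup E] [Lattice E] [Module ℝ E] [AddCommGroup F]
  [Module ℝ F]

/-- The sums of values of members of the family `T` at positive vectors that arise from `x` by
repeatedly splitting one of the coordinates into two positive summands. -/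
inductive PartitionSum (T : ι → MultilinearMap ℝ (fun _ : Fin m => E) F) :
    (Fin m → E) → F → Prop
  | single (i : ι) (x : Fin m → E) (hx : ∀ j, 0 ≤ x j) : PartitionSum T x (T i x)
  | add (x : Fin m → E) (j : Fin m) (a b : E) (g h : F) (hab : x j = a + b)
      (hg : PartitionSum T (Function.update x j a) g)
      (hh : PartitionSum T (Function.update x j b) h) : PartitionSum T x (g + h)

variable {T : ι → MultilinearMap ℝ (fun _ : Fin m => E) F}

section

variable [IsOrderedAddMonoid E]

theorem PartitionSum.nonneg {x : Fin m → E} {g : F} (h : PartitionSum T x g) (k : Fin m) :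
    0 ≤ x k := by
  induction h with
  | single i x hx => exact hx k
  | add x j a b g h hab _ _ ihg ihh =>
    by_cases hk : k = j
    · subst hk
      rw [hab]
      exact add_nonneg (by simpa using ihg) (by simpa using ihh)
    · simpa [hk] using ihg

/-- This yields subadditivity of the supremum; superadditivity is built into the constructor `add`.
Because splittings form a tree, no global grid is needed: the new splitting is pushed down the tree
to the leaves. -/
theorem PartitionSum.exists_split {x : Fin m → E} {g : F} (h : PartitionSum T x g) (j : Fin m)
    {a b : E} (ha : 0 ≤ a) (hb : 0 ≤ b) (hab : x j = a + b) :
    ∃ g₁ g₂, PartitionSum T (Function.update x j a) g₁ ∧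
      PartitionSum T (Function.update x j b) g₂ ∧ g = g₁ + g₂ := by
  induction h generalizing a b with
  | single i x hx =>
    have hu : ∀ c, 0 ≤ c → ∀ k, 0 ≤ Function.update x j c k := fun c hc k => by
      by_cases hk : k = j
      · subst hk; simpa using hc
      · simpa [hk] using hx k
    refine ⟨_, _, .single i _ (hu a ha), .single i _ (hu b hb), ?_⟩
    rw [← MultilinearMap.map_update_add, ← hab, Function.update_eq_self]
  | add x k c d g h hcd hg hh ihg ihh =>
    by_cases hk : k = j
    · subst hk
      have hc : 0 ≤ c := by simpa using hg.nonneg k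
      have hd : 0 ≤ d := by simpa using hh.nonneg k
      -- Two splittings of the same coordinate are exchanged through a common refinement; for
      -- different coordinates the updates simply commute.
      obtain ⟨p, q, r, s, hp, hq, hr, hs, rfl, rfl, rfl, rfl⟩ :=
        exists_common_refinement ha hb hc hd (hab.symm.trans hcd)
      obtain ⟨g₁, g₂, hg₁, hg₂, rfl⟩ := ihg hp hr (by simp)
      obtain ⟨h₁, h₂, hh₁, hh₂, rfl⟩ := ihh hq hs (by simp)
      simp only [Function.update_idem] at hg₁ hg₂ hh₁ hh₂
      exact ⟨g₁ + h₁, g₂ + h₂,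
        .add _ k p q _ _ (by simp) (by simpa using hg₁) (by simpa using hh₁),
        .add _ k r s _ _ (by simp) (by simpa using hg₂) (by simpa using hh₂),
        add_add_add_comm _ _ _ _⟩
    · have hk' : j ≠ k := fun h => hk h.symm
      obtain ⟨g₁, g₂, hg₁, hg₂, rfl⟩ := ihg ha hb (by simpa [hk'] using hab)
      obtain ⟨h₁, h₂, hh₁, hh₂, rfl⟩ := ihh ha hb (by simpa [hk'] using hab)
      rw [Function.update_comm hk] at hg₁ hg₂ hh₁ hh₂
      exact ⟨g₁ + h₁, g₂ + h₂, .add _ k c d _ _ (by simpa [hk] using hcd) hg₁ hh₁,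
        .add _ k c d _ _ (by simpa [hk] using hcd) hg₂ hh₂, add_add_add_comm _ _ _ _⟩

end

theorem PartitionSum.update_smul [IsOrderedModule ℝ E] {x : Fin m → E} {g : F}
    (h : PartitionSum T x g) (j : Fin m) {r : ℝ} (hr : 0 ≤ r) :
    PartitionSum T (Function.update x j (r • x j)) (r • g) := by
  induction h with
  | single i x hx =>
    have := MultilinearMap.map_update_smul (T i) x j r (x j)
    rw [Function.update_eq_self] at this
    rw [← this]
    refine .single i _ fun k => ?_
    by_cases hk : k = j
    · subst hk; simpa using smul_nonneg hr (hx k)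
    · simpa [hk] using hx k
  | add x k c d g h hcd hg hh ihg ihh =>
    rw [smul_add]
    by_cases hk : k = j
    · subst hk
      refine .add _ k (r • c) (r • d) _ _ (by simp [hcd]) ?_ ?_
      · simpa using ihg
      · simpa using ihh
    · have hk' : j ≠ k := fun h => hk h.symm
      refine .add _ k c d _ _ (by simpa [hk] using hcd) ?_ ?_
      · rw [Function.update_comm hk'] ; simpa [hk'] using ihg
      · rw [Function.update_comm hk'] ; simpa [hk'] using ihh

theorem PartitionSum.comp_perm (hT : ∀ i (σ : Equiv.Perm (Fin m)) (x : Fin m → E),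
    T i (fun k => x (σ k)) = T i x) {x : Fin m → E} {g : F} (h : PartitionSum T x g)
    (σ : Equiv.Perm (Fin m)) : PartitionSum T (fun k => x (σ k)) g := by
  -- Splitting coordinate `j` becomes splitting coordinate `σ.symm j` of the permuted tuple.
  have hu : ∀ (x : Fin m → E) j a, (fun k => Function.update x j a (σ k)) =
      Function.update (fun k => x (σ k)) (σ.symm j) a := fun x j a => by
    funext k
    by_cases hk : σ k = j
    · have : k = σ.symm j := by rw [← hk]; simp
      subst this; simp
    · have : k ≠ σ.symm j := fun h => hk (by rw [h]; simp)
      simp [hk, this]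
  induction h with
  | single i x hx =>
    rw [← hT i σ x]
    exact .single i _ fun k => hx _
  | add x j a b g h hab _ _ ihg ihh =>
    rw [hu] at ihg ihh
    exact .add _ (σ.symm j) a b _ _ (by simpa using hab) ihg ihh

/-- Additivity of `U` carries the bound up the tree. Used both for boundedness of the sums and for
minimality of their supremum. -/
theorem PartitionSum.le [PartialOrder F] [IsOrderedAddMonoid F]
    {U : MultilinearMap ℝ (fun _ : Fin m => E) F}
    (hU : ∀ i (x : Fin m → E), (∀ k, 0 ≤ x k) → T i x ≤ U x) {x : Fin m → E} {g : F}
    (h : PartitionSum T x g) : g ≤ U x := by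
  induction h with
  | single i x hx => exact hU i x hx
  | add x j a b g h hab _ _ ihg ihh =>
    rw [← Function.update_eq_self j x, hab, MultilinearMap.map_update_add]
    exact add_le_add ihg ihh

end PartitionSum

/-! ### Extension of multilinear functions from the positive cone. -/

section ConeExtension

variable {E F : Type*} {m : ℕ} [AddCommGroup E] [Lattice E] [IsOrderedAddMonoid E] [Module ℝ E]
  [IsOrderedModule ℝ E] [AddCommGroup F] [Module ℝ F]

/-- A function on the `m`-fold product of the positive cone that is additive and positively
homogeneous in each variable. -/
structure IsConeMultilinear (S : (Fin m → E) → F) : Prop where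
  update_add : ∀ (x : Fin m → E) (j : Fin m) (a b : E), (∀ k, 0 ≤ x k) → 0 ≤ a → 0 ≤ b →
    S (Function.update x j (a + b)) = S (Function.update x j a) + S (Function.update x j b)
  update_smul : ∀ (x : Fin m → E) (j : Fin m) (r : ℝ) (a : E), (∀ k, 0 ≤ x k) → 0 < r → 0 ≤ a →
    S (Function.update x j (r • a)) = r • S (Function.update x j a)

/-- The positive part for `true`, the negative part for `false`. -/
def signedPart (e : Bool) (v : E) : E := if e then v⁺ else v⁻

omit [IsOrderedAddMonoid E] [Module ℝ E] [IsOrderedModule ℝ E] in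
theorem signedPart_nonneg (e : Bool) (v : E) : 0 ≤ signedPart e v := by
  cases e
  · exact negPart_nonneg v
  · exact posPart_nonneg v

/-- The product of the signs of a sign vector. -/
def signProd (e : Fin m → Bool) : ℝ := ∏ i, if e i then 1 else -1

theorem signProd_update_not (e : Fin m → Bool) (j : Fin m) :
    signProd (Function.update e j (!e j)) = -signProd e := by
  unfold signProd
  rw [← Finset.mul_prod_erase _ _ (Finset.mem_univ j),
    ← Finset.mul_prod_erase Finset.univ (fun i => if e i then (1 : ℝ) else -1)
      (Finset.mem_univ j), ← neg_mul]
  congr 1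
  · cases h : e j <;> simp
  · refine Finset.prod_congr rfl fun i hi => ?_
    simp [Finset.ne_of_mem_erase hi]

/-- Flipping the sign at `j` pairs the terms so that they cancel. -/
theorem sum_signProd_smul_eq_zero (j : Fin m) (f : (Fin m → Bool) → F)
    (hf : ∀ e, f (Function.update e j (!e j)) = f e) : ∑ e, signProd e • f e = 0 := by
  refine Finset.sum_involution (fun e _ => Function.update e j (!e j)) ?_ ?_ ?_ ?_
  · intro e _
    simp [signProd_update_not, hf]
  · intro e _ _ h
    have := congrFun h j
    simp at this
  · intro e _; exact Finset.mem_univ _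
  · intro e _; simp

omit [IsOrderedAddMonoid E] [Module ℝ E] [IsOrderedModule ℝ E] in
theorem update_signedPart (e : Fin m → Bool) (x : Fin m → E) (j : Fin m) (v : E) :
    (fun i => signedPart (e i) (Function.update x j v i)) =
      Function.update (fun i => signedPart (e i) (x i)) j (signedPart (e j) v) := by
  funext i
  by_cases h : i = j
  · subst h; simp
  · simp [h]

omit [IsOrderedAddMonoid E] [Module ℝ E] [IsOrderedModule ℝ E] in
theorem update_signedPart_update_not (e : Fin m → Bool) (x : Fin m → E) (j : Fin m) (a : E) :
    Function.update (fun i => signedPart (Function.update e j (!e j) i) (x i)) j a =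
      Function.update (fun i => signedPart (e i) (x i)) j a := by
  funext i
  by_cases h : i = j
  · subst h; simp
  · simp [h]

/-- The alternating sum of the values of `S` at the positive and negative parts of the
coordinates. -/
def coneSum (S : (Fin m → E) → F) (x : Fin m → E) : F :=
  ∑ e, signProd e • S (fun i => signedPart (e i) (x i))

namespace IsConeMultilinear

variable {S : (Fin m → E) → F}

omit [IsOrderedAddMonoid E] [IsOrderedModule ℝ E] in
theorem update_zero (hS : IsConeMultilinear S) {x : Fin m → E} (hx : ∀ k, 0 ≤ x k) (j : Fin m) :
    S (Function.update x j 0) = 0 := by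
  have := hS.update_add x j 0 0 hx le_rfl le_rfl
  rwa [add_zero, left_eq_add] at this

-- The alternating sum does not depend on how the `j`-th entry is written as a difference of
-- positive vectors. With `v = p - q`, additivity applied to `v⁺ + q = v⁻ + p` makes the error terms
-- invariant under the flip at `j`, so they cancel. Linearity in that entry can then be checked with
-- convenient representations.
omit [IsOrderedModule ℝ E] in
theorem coneSum_update_sub (hS : IsConeMultilinear S) (x : Fin m → E) (j : Fin m) {p q : E}
    (hp : 0 ≤ p) (hq : 0 ≤ q) :
    coneSum S (Function.update x j (p - q)) = ∑ e, signProd e •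
      S (Function.update (fun i => signedPart (e i) (x i)) j (if e j then p else q)) := by
  unfold coneSum
  simp only [update_signedPart]
  rw [← sub_eq_zero, ← Finset.sum_sub_distrib]
  simp only [← smul_sub]
  refine sum_signProd_smul_eq_zero j _ fun e => ?_
  simp only [update_signedPart_update_not, Function.update_self]
  set φ : E → F := fun a => S (Function.update (fun i => signedPart (e i) (x i)) j a) with hφ
  have hadd : ∀ {a b}, 0 ≤ a → 0 ≤ b → φ (a + b) = φ a + φ b := fun ha hb =>
    hS.update_add _ j _ _ (fun k => signedPart_nonneg _ _) ha hb
  have key : φ (p - q)⁺ + φ q = φ (p - q)⁻ + φ p := by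
    rw [← hadd (posPart_nonneg _) hq, ← hadd (negPart_nonneg _) hp]
    congr 1
    have h1 := posPart_sub_negPart (p - q)
    rw [sub_eq_iff_eq_add] at h1
    rw [h1]; abel
  have key' : φ (p - q)⁺ - φ p = φ (p - q)⁻ - φ q := by
    rw [sub_eq_sub_iff_add_eq_add, key]
  have hflip : ∀ b : Bool, φ (signedPart (!b) (p - q)) - φ (if !b then p else q) =
      φ (signedPart b (p - q)) - φ (if b then p else q) := by
    rintro (_ | _)
    exacts [key', key'.symm]
  exact hflip (e j)

omit [IsOrderedModule ℝ E] in
theorem coneSum_update_add (hS : IsConeMultilinear S) (x : Fin m → E) (j : Fin m) (v w : E) :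
    coneSum S (Function.update x j (v + w)) =
      coneSum S (Function.update x j v) + coneSum S (Function.update x j w) := by
  have hvw : v + w = (v⁺ + w⁺) - (v⁻ + w⁻) := by
    rw [add_sub_add_comm, posPart_sub_negPart, posPart_sub_negPart]
  rw [hvw, hS.coneSum_update_sub x j (add_nonneg (posPart_nonneg _) (posPart_nonneg _))
    (add_nonneg (negPart_nonneg _) (negPart_nonneg _))]
  simp only [coneSum, update_signedPart]
  rw [← Finset.sum_add_distrib]
  refine Finset.sum_congr rfl fun e _ => ?_
  have : (if e j then v⁺ + w⁺ else v⁻ + w⁻) = signedPart (e j) v + signedPart (e j) w := by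
    cases e j <;> rfl
  rw [this, hS.update_add _ j _ _ (fun k => signedPart_nonneg _ _) (signedPart_nonneg _ _)
    (signedPart_nonneg _ _), smul_add]

theorem coneSum_update_smul_of_pos (hS : IsConeMultilinear S) (x : Fin m → E) (j : Fin m) {r : ℝ}
    (hr : 0 < r) (v : E) :
    coneSum S (Function.update x j (r • v)) = r • coneSum S (Function.update x j v) := by
  have hv : r • v = r • v⁺ - r • v⁻ := by rw [← smul_sub, posPart_sub_negPart]
  rw [hv, hS.coneSum_update_sub x j (smul_nonneg hr.le (posPart_nonneg _))
    (smul_nonneg hr.le (negPart_nonneg _))]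
  simp only [coneSum, update_signedPart]
  rw [Finset.smul_sum]
  refine Finset.sum_congr rfl fun e _ => ?_
  have : (if e j then r • v⁺ else r • v⁻) = r • signedPart (e j) v := by
    cases e j <;> rfl
  rw [this, hS.update_smul _ j r _ (fun k => signedPart_nonneg _ _) hr (signedPart_nonneg _ _),
    smul_comm]

theorem coneSum_update_smul (hS : IsConeMultilinear S) (x : Fin m → E) (j : Fin m) (r : ℝ) (v : E) :
    coneSum S (Function.update x j (r • v)) = r • coneSum S (Function.update x j v) := by
  have h0 : coneSum S (Function.update x j 0) = 0 := by
    have := hS.coneSum_update_add x j 0 0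
    rwa [add_zero, left_eq_add] at this
  rcases lt_trichotomy r 0 with h | rfl | h
  · have h1 := hS.coneSum_update_add x j (r • v) ((-r) • v)
    rw [← add_smul, add_neg_cancel, zero_smul, h0,
      hS.coneSum_update_smul_of_pos x j (neg_pos.2 h), neg_smul] at h1
    exact (sub_eq_zero.1 (by rw [sub_eq_add_neg]; exact h1.symm))
  · simp [h0]
  · exact hS.coneSum_update_smul_of_pos x j h v

/-- The multilinear extension of a function that is additive and positively homogeneous in each
variable on the positive cone. -/
def extension (hS : IsConeMultilinear S) : MultilinearMap ℝ (fun _ : Fin m => E) F :=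
  MultilinearMap.mk' (coneSum S) hS.coneSum_update_add hS.coneSum_update_smul

/-- Any sign vector other than the all-positive one inserts a vanishing negative part, where `S` is
zero. -/
theorem extension_apply_of_nonneg (hS : IsConeMultilinear S) {x : Fin m → E} (hx : ∀ k, 0 ≤ x k) :
    hS.extension x = S x := by
  change coneSum S x = S x
  unfold coneSum
  rw [Finset.sum_eq_single (fun _ => true)]
  · simp [signProd, signedPart, posPart_of_nonneg, hx]
  · intro e _ he
    obtain ⟨j, hj⟩ := Function.ne_iff.1 he
    have hj' : signedPart (e j) (x j) = 0 := by
      cases h : e j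
      · simp [signedPart, hx]
      · simp [h] at hj
    have h1 := hS.update_zero (x := fun i => signedPart (e i) (x i))
      (fun k => signedPart_nonneg _ _) j
    rw [← hj', Function.update_eq_self j (fun i => signedPart (e i) (x i))] at h1
    rw [h1, smul_zero]
  · simp

theorem extension_comp_perm (hS : IsConeMultilinear S) (σ : Equiv.Perm (Fin m))
    (hσ : ∀ x : Fin m → E, S (fun k => x (σ k)) = S x) (x : Fin m → E) :
    hS.extension (fun k => x (σ k)) = hS.extension x := by
  change coneSum S _ = coneSum S _
  unfold coneSum
  rw [← Equiv.sum_comp (σ.symm.arrowCongr (Equiv.refl Bool))]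
  refine Finset.sum_congr rfl fun e _ => ?_
  have h1 : σ.symm.arrowCongr (Equiv.refl Bool) e = fun k => e (σ k) := by
    funext k; simp [Equiv.arrowCongr]
  rw [h1, ← hσ fun i => signedPart (e i) (x i)]
  congr 1
  exact Equiv.prod_comp σ fun i => if e i then (1 : ℝ) else -1

end IsConeMultilinear

end ConeExtension

/-! ### Least upper bounds of families bounded on the cone. -/

section Supremum

variable {ι E F : Type*} {m : ℕ} [AddCommGroup E] [Lattice E] [IsOrderedAddMonoid E] [Module ℝ E]
  [IsOrderedModule ℝ E] [AddCommGroup F] [ConditionallyCompleteLattice F] [IsOrderedAddMonoid F]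
  [Module ℝ F] [IsOrderedModule ℝ F]

/-- The Riesz–Kantorovich formula for the supremum of a family of multilinear maps. -/
theorem isConeMultilinear_sSup_partitionSum [Nonempty ι]
    {T : ι → MultilinearMap ℝ (fun _ : Fin m => E) F} {D : MultilinearMap ℝ (fun _ : Fin m => E) F}
    (hD : ∀ i (x : Fin m → E), (∀ k, 0 ≤ x k) → T i x ≤ D x) :
    IsConeMultilinear (fun x => sSup {g | PartitionSum T x g}) := by
  have hne : ∀ x : Fin m → E, (∀ k, 0 ≤ x k) → {g | PartitionSum T x g}.Nonempty := fun x hx =>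
    ⟨_, .single (Classical.arbitrary ι) x hx⟩
  have hbdd : ∀ x : Fin m → E, BddAbove {g | PartitionSum T x g} := fun x =>
    ⟨D x, fun g hg => PartitionSum.le hD hg⟩
  have hu : ∀ {x : Fin m → E} {j : Fin m} {a : E}, (∀ k, 0 ≤ x k) → 0 ≤ a →
      ∀ k, 0 ≤ Function.update x j a k := fun {x j a} hx ha k => by
    by_cases hk : k = j
    · subst hk; simpa using ha
    · simpa [hk] using hx k
  have hsmul : ∀ (x : Fin m → E) (j : Fin m) (r : ℝ) (a : E), (∀ k, 0 ≤ x k) → 0 < r → 0 ≤ a →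
      r • sSup {g | PartitionSum T (Function.update x j a) g} ≤
        sSup {g | PartitionSum T (Function.update x j (r • a)) g} := by
    intro x j r a hx hr ha
    rw [← le_inv_smul_iff_of_pos hr]
    refine csSup_le (hne _ (hu hx ha)) fun g hg => ?_
    rw [le_inv_smul_iff_of_pos hr]
    refine le_csSup (hbdd _) ?_
    have := PartitionSum.update_smul hg j hr.le
    simpa using this
  refine ⟨fun x j a b hx ha hb => le_antisymm ?_ ?_, fun x j r a hx hr ha => le_antisymm ?_ ?_⟩
  · refine csSup_le (hne _ (hu hx (add_nonneg ha hb))) fun g hg => ?_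
    obtain ⟨g₁, g₂, h₁, h₂, rfl⟩ := PartitionSum.exists_split hg j ha hb (by simp)
    rw [Function.update_idem] at h₁ h₂
    exact add_le_add (le_csSup (hbdd _) h₁) (le_csSup (hbdd _) h₂)
  · rw [← le_sub_iff_add_le]
    refine csSup_le (hne _ (hu hx ha)) fun g hg => ?_
    rw [le_sub_comm]
    refine csSup_le (hne _ (hu hx hb)) fun h hh => ?_
    rw [le_sub_iff_add_le']
    exact le_csSup (hbdd _) (.add _ j a b g h (by simp) (by simpa using hg) (by simpa using hh))
  -- The reverse inequality is `hsmul` for the inverse scalar.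
  · have := hsmul x j r⁻¹ (r • a) hx (inv_pos.2 hr) (smul_nonneg hr.le ha)
    rwa [smul_smul, inv_mul_cancel₀ hr.ne', one_smul, inv_smul_le_iff_of_pos hr] at this
  · exact hsmul x j r a hx hr ha

/-- A family of symmetric multilinear maps into a Dedekind complete space that is bounded above on
the positive cone has a least upper bound, and this least upper bound is symmetric. -/
theorem exists_isLeast_upperBound [Nonempty ι]
    {T : ι → MultilinearMap ℝ (fun _ : Fin m => E) F} {D : MultilinearMap ℝ (fun _ : Fin m => E) F}
    (hD : ∀ i (x : Fin m → E), (∀ k, 0 ≤ x k) → T i x ≤ D x)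
    (hT : ∀ i (σ : Equiv.Perm (Fin m)) (x : Fin m → E), T i (fun k => x (σ k)) = T i x) :
    ∃ S : MultilinearMap ℝ (fun _ : Fin m => E) F,
      (∀ (σ : Equiv.Perm (Fin m)) (x : Fin m → E), S (fun k => x (σ k)) = S x) ∧
      (∀ i (x : Fin m → E), (∀ k, 0 ≤ x k) → T i x ≤ S x) ∧
      ∀ U : MultilinearMap ℝ (fun _ : Fin m => E) F,
        (∀ i (x : Fin m → E), (∀ k, 0 ≤ x k) → T i x ≤ U x) →
        ∀ x : Fin m → E, (∀ k, 0 ≤ x k) → S x ≤ U x := by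
  have hS := isConeMultilinear_sSup_partitionSum hD
  refine ⟨hS.extension, fun σ x => hS.extension_comp_perm σ (fun x => ?_) x, fun i x hx => ?_,
    fun U hU x hx => ?_⟩
  · congr 1
    ext g
    refine ⟨fun h => ?_, fun h => h.comp_perm hT σ⟩
    simpa using PartitionSum.comp_perm hT h σ.symm
  · rw [hS.extension_apply_of_nonneg hx]
    exact le_csSup ⟨D x, fun g hg => PartitionSum.le hD hg⟩ (.single i x hx)
  · rw [hS.extension_apply_of_nonneg hx]
    exact csSup_le ⟨_, .single (Classical.arbitrary ι) x hx⟩ fun g hg => PartitionSum.le hU hg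

end Supremum

end MultilinearMap

/-! ### The absolute value of a regular polynomial -/

namespace Complexification

theorem ofReal_add {E : Type*} [AddCommGroup E] (x y : E) : ofReal (x + y) = ofReal x + ofReal y := by ext <;> simp

theorem ofReal_smul {E : Type*} [AddCommGroup E] [Module ℝ E] (r : ℝ) (x : E) :
    ofReal (r • x) = (r : ℂ) • ofReal x := by
  ext <;> simp [-Complex.coe_smul]

theorem ofReal_comp_update {E : Type*} [AddCommGroup E] {m : ℕ} (x : Fin m → E) (j : Fin m) (a : E) :
    (fun k => ofReal (Function.update x j a k)) =
      Function.update (fun k => ofReal (x k)) j (ofReal a) := by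
  funext k
  by_cases hk : k = j
  · subst hk; simp
  · simp [hk]

variable {E F : Type*} {m : ℕ} [AddCommGroup E] [Module ℝ E] [AddCommGroup F] [Module ℝ F]

/-- The real multilinear map `x ↦ Re (c A(x))` on real vectors. -/
def rotatedRe (A : MultilinearMap ℂ (fun _ : Fin m => Complexification E) (Complexification F))
    (c : ℂ) : MultilinearMap ℝ (fun _ : Fin m => E) F :=
  MultilinearMap.mk' (fun x => (c • A (fun k => ofReal (x k))).re)
    (fun x j a b => by
      simp only [ofReal_comp_update, ofReal_add, A.map_update_add, smul_add, add_re])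
    (fun x j r a => by
      simp only [ofReal_comp_update, ofReal_smul, A.map_update_smul, smul_re, smul_im,
        Complex.ofReal_re, Complex.ofReal_im]
      module)

theorem rotatedRe_apply
    (A : MultilinearMap ℂ (fun _ : Fin m => Complexification E) (Complexification F)) (c : ℂ)
    (x : Fin m → E) : rotatedRe A c x = (c • A (fun k => ofReal (x k))).re := rfl

/-! ### Passing from positive vectors to complex vectors. -/

section Domination

variable [Lattice E] [PartialOrder F] [IsOrderedAddMonoid F]

/-- A real multilinear map that dominates all rotations of `A` at positive vectors dominates them
at all complex vectors. -/
theorem re_smul_map_le_of_mem_unimodularSums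
    {A : MultilinearMap ℂ (fun _ : Fin m => Complexification E) (Complexification F)}
    {S : MultilinearMap ℝ (fun _ : Fin m => E) F}
    (hS : ∀ c : ℂ, ‖c‖ = 1 → ∀ x : Fin m → E, (∀ k, 0 ≤ x k) → rotatedRe A c x ≤ S x)
    (p : Fin m → Complexification E × E) (hp : ∀ k, p k ∈ unimodularSums E) {c : ℂ}
    (hc : ‖c‖ = 1) : (c • A (fun k => (p k).1)).re ≤ S (fun k => (p k).2) := by
  classical
  set G : Set (Complexification E × E) := {p | ∃ c : ℂ, ‖c‖ = 1 ∧ 0 ≤ p.2 ∧ p.1 = c • ofReal p.2}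
    with hG
  have hfst : ∀ (p : Fin m → Complexification E × E) j q, (fun k => (Function.update p j q k).1) =
      Function.update (fun k => (p k).1) j q.1 := fun p j q => by
    funext k
    by_cases hk : k = j
    · subst hk; simp
    · simp [hk]
  have hsnd : ∀ (p : Fin m → Complexification E × E) j q, (fun k => (Function.update p j q k).2) =
      Function.update (fun k => (p k).2) j q.2 := fun p j q => by
    funext k
    by_cases hk : k = j
    · subst hk; simp
    · simp [hk]
  -- Induction on the set of coordinates allowed to be genuine sums; the others are single rotated
  -- positive vectors. Both sides are additive in a coordinate, which reduces it to generators.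
  have key : ∀ s : Finset (Fin m), ∀ p : Fin m → Complexification E × E,
      (∀ k ∈ s, p k ∈ unimodularSums E) → (∀ k ∉ s, p k ∈ G) →
      (c • A (fun k => (p k).1)).re ≤ S (fun k => (p k).2) := by
    intro s
    induction s using Finset.induction_on with
    | empty =>
      intro p _ hp
      have hp' : ∀ k, ∃ c : ℂ, ‖c‖ = 1 ∧ 0 ≤ (p k).2 ∧ (p k).1 = c • ofReal (p k).2 :=
        fun k => hp k (by simp)
      choose d hd h0 h1 using hp'
      have : (fun k => (p k).1) = fun k => d k • ofReal (p k).2 := funext h1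
      -- All the unimodular factors come out of `A` and merge with `c` into one rotation.
      rw [this, A.map_smul_univ, smul_smul]
      exact hS _ (by simp [hc, hd]) (fun k => (p k).2) h0
    | insert j s hj ih =>
      intro p hp hp'
      have hq : ∀ q ∈ unimodularSums E,
          (c • A (fun k => (Function.update p j q k).1)).re ≤
            S (fun k => (Function.update p j q k).2) := by
        intro q hq
        induction hq using AddSubmonoid.closure_induction with
        | mem q hq =>
          refine ih _ (fun k hk => ?_) fun k hk => ?_
          · have : k ≠ j := fun h => hj (h ▸ hk)
            simpa [this] using hp k (Finset.mem_insert_of_mem hk)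
          · by_cases hkj : k = j
            · subst hkj; simpa [hG] using hq
            · simpa [hkj] using hp' k (by simp [hkj, hk])
        | zero =>
          rw [hfst, hsnd]
          simp [MultilinearMap.map_update_zero]
        | add q r _ _ hq hr =>
          rw [hfst, hsnd] at hq hr ⊢
          simpa using add_le_add hq hr
      simpa using hq (p j) (hp j (Finset.mem_insert_self j s))
  exact key Finset.univ p (fun k _ => hp k) (by simp)

end Domination

end Complexification

namespace MultilinearMap

/-- A multilinear map that is positive on the positive cone is monotone there. -/
theorem le_of_nonneg_of_le {E F : Type*} {m : ℕ} [AddCommGroup E] [PartialOrder E]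
    [IsOrderedAddMonoid E] [Module ℝ E] [AddCommGroup F] [PartialOrder F] [IsOrderedAddMonoid F]
    [Module ℝ F] {S : MultilinearMap ℝ (fun _ : Fin m => E) F}
    (hS : ∀ x : Fin m → E, (∀ k, 0 ≤ x k) → 0 ≤ S x) {x y : Fin m → E} (hx : ∀ k, 0 ≤ x k)
    (hxy : ∀ k, x k ≤ y k) : S x ≤ S y := by
  classical
  have : y = x + (y - x) := by abel
  -- Every term of the expansion is nonnegative, and the one for the full set is `S x`.
  rw [this, S.map_add_univ, ← Finset.add_sum_erase _ _ (Finset.mem_univ Finset.univ)]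
  simp only [Finset.piecewise_univ]
  refine le_add_of_nonneg_right (Finset.sum_nonneg fun s _ => hS _ fun k => ?_)
  by_cases hk : k ∈ s
  · simpa [hk] using hx k
  · simpa [hk] using hxy k

end MultilinearMap

/-- A positive polynomial is positive on the positive cone with respect to any symmetric multilinear
map that generates it. -/
theorem IsPositivePolynomial.nonneg_of_isGeneratedBy {E F : Type*} {m : ℕ} [AddCommGroup E]
    [Module ℝ E] [Lattice E] [AddCommGroup F] [Module ℝ F] [Lattice F] {P : E → F}
    (hP : IsPositivePolynomial m P) {A : MultilinearMap ℝ (fun _ : Fin m => E) F}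
    (hA : IsGeneratedBy P A) {x : Fin m → E} (hx : ∀ k, 0 ≤ x k) : 0 ≤ A x := by
  obtain ⟨B, hB, hB0⟩ := hP
  have : A - B = 0 := by
    refine eq_zero_of_symmetric_of_diagonal _ (fun σ x => ?_) fun x => ?_
    · simp [hA.1 σ x, hB.1 σ x]
    · simp [← hA.2, ← hB.2]
  rw [sub_eq_zero.1 this]
  exact hB0 x hx

theorem IsGeneratedBy.sub {E F : Type*} {m : ℕ} [AddCommGroup E]
    [Module ℝ E] [AddCommGroup F] [Module ℝ F] {P Q : E → F}
    {A B : MultilinearMap ℝ (fun _ : Fin m => E) F} (hA : IsGeneratedBy P A)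
    (hB : IsGeneratedBy Q B) : IsGeneratedBy (fun x => P x - Q x) (A - B) :=
  ⟨fun σ x => by simp [hA.1 σ x, hB.1 σ x], fun x => by simp [hA.2, hB.2]⟩

/-- A regular polynomial and its negative are dominated by a common multilinear map. -/
theorem IsRegularPolynomial.exists_abs_le {E F : Type*} {m : ℕ} [AddCommGroup E] [Module ℝ E]
    [Lattice E] [AddCommGroup F] [Module ℝ F] [Lattice F] [IsOrderedAddMonoid F] {P : E → F}
    (hP : IsRegularPolynomial m P) {A : MultilinearMap ℝ (fun _ : Fin m => E) F}
    (hA : IsGeneratedBy P A) :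
    ∃ D : MultilinearMap ℝ (fun _ : Fin m => E) F, ∀ x : Fin m → E, (∀ k, 0 ≤ x k) →
      |A x| ≤ D x := by
  obtain ⟨P₁, P₂, ⟨B, hB, hB0⟩, ⟨C, hC, hC0⟩, rfl⟩ := hP
  have h : A - (B - C) = 0 := by
    refine eq_zero_of_symmetric_of_diagonal _ (fun σ x => ?_) fun x => ?_
    · simp [hA.1 σ x, hB.1 σ x, hC.1 σ x]
    · simp [← hA.2, ← hB.2, ← hC.2]
  refine ⟨B + C, fun x hx => ?_⟩
  rw [sub_eq_zero.1 h, add_apply, sub_apply]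
  rw [abs_le', neg_sub]
  have h1 : B x - C x ≤ B x := sub_le_self _ (hC0 x hx)
  have h2 : C x - B x ≤ C x := sub_le_self _ (hB0 x hx)
  exact ⟨h1.trans (le_add_of_nonneg_right (hC0 x hx)),
    h2.trans (le_add_of_nonneg_left (hB0 x hx))⟩

/-- For every regular `m`-homogeneous polynomial `P` between complex Banach lattices (the
complexifications of the real Banach lattices `E` and `F`), with `F` Dedekind complete, the absolute
value `|P|` exists and `|P(z)| ≤ |P|(|z|)` for all `z`. -/
theorem proposition2p5 {E F : Type*}
    [NormedAddCommGroup E] [NormedSpace ℝ E] [Lattice E] [IsOrderedAddMonoid E]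
    [IsOrderedModule ℝ E] [HasSolidNorm E] [CompleteSpace E]
    [NormedAddCommGroup F] [NormedSpace ℝ F] [ConditionallyCompleteLattice F]
    [IsOrderedAddMonoid F] [IsOrderedModule ℝ F] [HasSolidNorm F] [CompleteSpace F]
    (m : ℕ) (P : ComplexRegularPolynomial m E F) :
    ∃ absP : RegularPolynomial m E F, P.IsAbs absP ∧
      ∀ z : Complexification E, (P z).modulus ≤ absP z.modulus := by
  obtain ⟨A, hAsymm, hPA⟩ := P.isHomogeneous
  have hsymm : ∀ (c : ℂ) (σ : Equiv.Perm (Fin m)) (x : Fin m → E),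
      Complexification.rotatedRe A c (fun k => x (σ k)) = Complexification.rotatedRe A c x := by
    intro c σ x
    rw [Complexification.rotatedRe_apply, Complexification.rotatedRe_apply,
      ← hAsymm σ fun k => Complexification.ofReal (x k)]
  have hgen : ∀ c : ℂ, IsGeneratedBy
      (fun x => (c • P (Complexification.ofReal x)).re) (Complexification.rotatedRe A c) :=
    fun c => ⟨hsymm c, fun x => by dsimp only; rw [hPA]; rfl⟩
  obtain ⟨D₀, hD₀⟩ := P.regular_re.exists_abs_le (A := Complexification.rotatedRe A 1)
    (by simpa using hgen 1)
  -- The imaginary part is the rotation with `c = -i`.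
  obtain ⟨D₁, hD₁⟩ := P.regular_im.exists_abs_le (A := Complexification.rotatedRe A (-Complex.I))
    (by simpa using hgen (-Complex.I))
  have hD : ∀ (c : {c : ℂ // ‖c‖ = 1}) (x : Fin m → E), (∀ k, 0 ≤ x k) →
      Complexification.rotatedRe A c x ≤ (D₀ + D₁) x := by
    rintro ⟨c, hc⟩ x hx
    have h0 := hD₀ x hx
    have h1 := hD₁ x hx
    have hre : |c.re| ≤ 1 := hc ▸ Complex.abs_re_le_norm c
    have him : |-c.im| ≤ 1 := by rw [abs_neg]; exact hc ▸ Complex.abs_im_le_norm c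
    have aux : ∀ (r : ℝ) (v : F), |r| ≤ 1 → r • v ≤ |v| := fun r v hr => by
      refine (le_abs_self _).trans ((Complexification.abs_smul_le r v).trans ?_)
      simpa using smul_le_smul_of_nonneg_right hr (abs_nonneg v)
    have h2 := add_le_add ((aux _ _ hre).trans h0) ((aux _ _ him).trans h1)
    refine Eq.trans_le ?_ h2
    simp [Complexification.rotatedRe_apply, sub_eq_add_neg]
  have : Nonempty {c : ℂ // ‖c‖ = 1} := ⟨⟨1, by simp⟩⟩
  obtain ⟨S, hSsymm, hSub, hSleast⟩ := MultilinearMap.exists_isLeast_upperBound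
    (T := fun c : {c : ℂ // ‖c‖ = 1} => Complexification.rotatedRe A c) hD fun c => hsymm c
  have hSdom : ∀ c : ℂ, ‖c‖ = 1 → ∀ x : Fin m → E, (∀ k, 0 ≤ x k) →
      Complexification.rotatedRe A c x ≤ S x := fun c hc => hSub ⟨c, hc⟩
  have hS0 : ∀ x : Fin m → E, (∀ k, 0 ≤ x k) → 0 ≤ S x := fun x hx => by
    refine Complexification.RotationsLE.nonneg
      (z := A fun k => Complexification.ofReal (x k)) fun c hc => hSdom c hc x hx
  have hSgen : IsGeneratedBy (fun x => S fun _ => x) S := ⟨hSsymm, fun _ => rfl⟩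
  have hrot : ∀ θ : ℝ, ∃ c : ℂ, ‖c‖ = 1 ∧ ∀ w : Complexification F,
      (c • w).re = Real.cos θ • w.re + Real.sin θ • w.im := fun θ =>
    ⟨⟨Real.cos θ, -Real.sin θ⟩, by
      rw [Complex.norm_eq_sqrt_sq_add_sq]; simp, fun w => by simp [sub_eq_add_neg]⟩
  refine ⟨⟨fun x => S fun _ => x, fun x => S fun _ => x, 0, ⟨S, hSgen, hS0⟩, .zero m, by simp⟩,
    ⟨?_, ?_⟩, fun z => (Complexification.isModulus_modulus (P z)).2 ?_⟩
  · rintro _ ⟨θ, _, rfl⟩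
    obtain ⟨c, hc, hcw⟩ := hrot θ
    refine ⟨S - Complexification.rotatedRe A c, ?_, fun x hx => sub_nonneg.2 (hSdom c hc x hx)⟩
    have := hSgen.sub (hgen c)
    simp only [hcw] at this
    exact this
  · intro Q hQ
    obtain ⟨Q₁, Q₂, ⟨B, hB, -⟩, ⟨C, hC, -⟩, hQ12⟩ := Q.2
    have hQgen : IsGeneratedBy Q.1 (B - C) := by
      rw [hQ12]; exact hB.sub hC
    -- Polarization lets the upper bound property of `Q` be tested on its generating map `B - C`, to
    -- which minimality of `S` applies.
    refine ⟨(B - C) - S, hQgen.sub hSgen, fun x hx => sub_nonneg.2 (hSleast _ ?_ x hx)⟩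
    rintro ⟨c, hc⟩ y hy
    obtain ⟨θ, hθ, hcos, hsin⟩ := Complexification.exists_angle hc
    have h1 : IsPositivePolynomial m (fun x => Q x -
        (Real.cos θ • (P (Complexification.ofReal x)).re +
          Real.sin θ • (P (Complexification.ofReal x)).im)) := hQ ⟨θ, hθ, rfl⟩
    refine sub_nonneg.1 (h1.nonneg_of_isGeneratedBy (A := (B - C) - _) ?_ hy)
    refine hQgen.sub ?_
    convert hgen c using 3
    simp [hcos, hsin, sub_eq_add_neg]
  · rintro _ ⟨θ, _, rfl⟩
    obtain ⟨c, hc, hcw⟩ := hrot θ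
    change Real.cos θ • (P z).re + Real.sin θ • (P z).im ≤ S fun _ => z.modulus
    rw [← hcw]
    set u := z.modulus with hu
    have hz : Complexification.RotationsLE z u := (Complexification.isModulus_modulus z).rotationsLE
    have hbound : ∀ ε : ℝ, 0 < ε → (c • P z).re ≤ (1 + ε) ^ m • S fun _ => u := by
      intro ε hε
      obtain ⟨b, hb, hbu⟩ := hz.exists_mem_unimodularSums hε
      have h1 := Complexification.re_smul_map_le_of_mem_unimodularSums hSdom
        (fun _ => (z, b)) (fun _ => hb) hc
      have h2 := MultilinearMap.le_of_nonneg_of_le hS0 (x := fun _ => b)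
        (y := fun _ => (1 + ε) • u)
        (fun _ => Complexification.nonneg_of_mem_unimodularSums hb) fun _ => hbu
      have h3 := S.map_smul_univ (fun _ => 1 + ε) fun _ => u
      simp only [Finset.prod_const, Finset.card_univ, Fintype.card_fin] at h3
      rw [hPA, ← h3]
      exact h1.trans h2
    -- The order of a Banach lattice is closed under norm limits, so the bound survives `ε → 0`.
    have ht : Tendsto (fun ε : ℝ => (1 + ε) ^ m • S fun _ => u) (𝓝[>] 0)
        (𝓝 ((1 + 0 : ℝ) ^ m • S fun _ => u)) := by
      refine Tendsto.mono_left (Continuous.tendsto ?_ 0) nhdsWithin_le_nhds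
      fun_prop
    rw [add_zero, one_pow, one_smul] at ht
    exact ge_of_tendsto ht (eventually_mem_nhdsWithin.mono fun ε hε => hbound ε hε)
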